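/- Let $F$ be a Dedekind complete real $\Phi$-algebra, that is, a Dedekind complete vector lattice with an associative multiplication making it an $f$-algebra with a multiplicative unit, and let $E = F + iF$ be its complexification with the induced multiplication and with the modulus $|x+iy| = \sup\{(\cos\theta)x + (\sin\theta)y : \theta\in[0,2\pi]\} \in F$ for $x,y \in F$ (a Dedekind complete complex $\Phi$-algebra). A weak order unit is an element $r \in F$ with $r \ge 0$ such that $x = 0$ whenever $x \in F$ and $r \wedge |x| = 0$. For $c \in E$ and a weak order unit $r$, let $N(c,r) = \{z \in E : r - |z-c| \text{ is a weak order unit}\}$. A function $f \colon D \to E$ with $D \subseteq E$ is called super order differentiable at $p \in D$ with derivative $f'(p) \in E$ if there is a weak order unit $s$ with $N(p,s) \subseteq D$ and, for every downwards directed set $\Delta \subseteq F$ with $\inf \Delta = 0$, there is a set $\mathcal{E} \subseteq F$ with $\inf \mathcal{E} = 0$ such that for every $\varepsilon \in \mathcal{E}$ there is a $\delta \in \Delta$ with $$ z \in D \text{ and } |z-p| \le \delta \implies |f(z) - f(p) - (z-p)f'(p)| \le |z-p|\,\varepsilon. $$ Let $c \in E$, let $r$ be a weak order unit, and let $f \colon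 N(c,r) \to E$ be super order differentiable at every point of $N(c,r)$ with $f' = 0$. Then $f$ is constant. -/

import Mathlib

/-- A real `Φ`-algebra: an associative unital real algebra which is a vector lattice, in which
products of positive elements are positive, and in which multiplication by a positive element
(on either side) preserves disjointness (an `f`-algebra with a multiplicative unit).
Commutativity is not assumed. -/
class PhiAlgebra (F : Type*) [Ring F] [Lattice F] [Algebra ℝ F] : Prop
    extends IsOrderedAddMonoid F, PosSMulMono ℝ F where
  mul_nonneg' : ∀ x y : F, 0 ≤ x → 0 ≤ y → 0 ≤ x * y
  inf_mul_right' : ∀ x y z : F, x ⊓ y = 0 → 0 ≤ z → (x * z) ⊓ y = 0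
  inf_mul_left' : ∀ x y z : F, x ⊓ y = 0 → 0 ≤ z → (z * x) ⊓ y = 0

/-- The complexification `E = F + iF` of `F`: pairs `(re, im)`, with `i ^ 2 = -1`. -/
abbrev Complexification (F : Type*) [Ring F] : Type _ := QuadraticAlgebra F (-1) 0

namespace Complexification

variable {F : Type*} [Ring F] [ConditionallyCompleteLattice F] [Algebra ℝ F]

/-- The modulus `|x + iy| = sup {(cos θ) x + (sin θ) y : θ ∈ [0, 2π]}`, an element of `F`. -/
noncomputable def modulus (z : Complexification F) : F :=
  sSup ((fun θ : ℝ => Real.cos θ • z.re + Real.sin θ • z.im) '' Set.Icc 0 (2 * Real.pi))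

end Complexification

/-- The supremum defining the modulus is a genuine supremum. -/
theorem Complexification.isLUB_modulus {F : Type*} [Ring F] [ConditionallyCompleteLattice F]
    [Algebra ℝ F] [PhiAlgebra F] (z : Complexification F) :
    IsLUB ((fun θ : ℝ => Real.cos θ • z.re + Real.sin θ • z.im) '' Set.Icc 0 (2 * Real.pi))
      (Complexification.modulus z) := by
  have key : ∀ (t : ℝ) (x : F), |t| ≤ 1 → t • x ≤ |x| := by
    intro t x ht
    obtain ⟨h1, h2⟩ := abs_le.mp ht
    have hx : (0 : F) ≤ |x| - x := sub_nonneg.mpr (le_abs_self x)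
    have hx' : (0 : F) ≤ |x| + x := by
      have h := neg_le_abs x
      rw [← sub_nonneg] at h
      simpa using h
    have e1 : (0 : F) ≤ ((1 + t) / 2) • (|x| - x) := smul_nonneg (by linarith) hx
    have e2 : (0 : F) ≤ ((1 - t) / 2) • (|x| + x) := smul_nonneg (by linarith) hx'
    have e3 : |x| - t • x = ((1 + t) / 2) • (|x| - x) + ((1 - t) / 2) • (|x| + x) := by
      module
    exact sub_nonneg.mp (e3 ▸ add_nonneg e1 e2)
  refine isLUB_csSup ⟨_, Set.mem_image_of_mem _ ⟨le_rfl, by positivity⟩⟩ ⟨|z.re| + |z.im|, ?_⟩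
  rintro _ ⟨θ, -, rfl⟩
  exact add_le_add (key _ _ (Real.abs_cos_le_one θ)) (key _ _ (Real.abs_sin_le_one θ))

/-- `r` is a weak order unit of the vector lattice `F`: it is positive and only `0` is disjoint
from it. -/
def IsWeakOrderUnit {F : Type*} [Ring F] [Lattice F] (r : F) : Prop :=
  0 ≤ r ∧ ∀ x : F, r ⊓ |x| = 0 → x = 0

/-- `x ≪ y`: the difference `y - x` is a weak order unit. -/
def OrderLL {F : Type*} [Ring F] [Lattice F] (x y : F) : Prop := IsWeakOrderUnit (y - x)

/-- The order neighbourhood `N(c, r) = {z ∈ E : |z - c| ≪ r}`. -/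
def orderNhd {F : Type*} [Ring F] [ConditionallyCompleteLattice F] [Algebra ℝ F]
    (c : Complexification F) (r : F) : Set (Complexification F) :=
  {z | OrderLL (Complexification.modulus (z - c)) r}

/-- `A ↘ 0`: the infimum of `A` is `0`. -/
def InfZero {F : Type*} [Ring F] [Lattice F] (A : Set F) : Prop := IsGLB A 0

/-- `A ↓ 0`: the infimum of `A` is `0` and `A` is downwards directed. -/
def DecreasesToZero {F : Type*} [Ring F] [Lattice F] (A : Set F) : Prop :=
  InfZero A ∧ DirectedOn (fun a b => b ≤ a) A

/-- `f : D → E`, with `D ⊆ E`, is super order differentiable at `p ∈ D` with derivative `d`. -/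
def HasSuperOrderDerivAt {F : Type*} [Ring F] [ConditionallyCompleteLattice F] [Algebra ℝ F]
    {D : Set (Complexification F)} (f : D → Complexification F) (p : D)
    (d : Complexification F) : Prop :=
  ∃ r : F, IsWeakOrderUnit r ∧ orderNhd (p : Complexification F) r ⊆ D ∧
    ∀ Δ : Set F, DecreasesToZero Δ → ∃ Ε : Set F, InfZero Ε ∧
      ∀ ε ∈ Ε, ∃ δ ∈ Δ, ∀ z : D,
        Complexification.modulus ((z : Complexification F) - (p : Complexification F)) ≤ δ →
        Complexification.modulus
            (f z - f p - ((z : Complexification F) - (p : Complexification F)) * d) ≤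
          Complexification.modulus ((z : Complexification F) - (p : Complexification F)) * ε

/-! Fix `z`, put `v = |z - c|` and restrict `f` to the path `a ↦ c + a(z - c)`, whose parameter runs
over the order interval `[0, 1]` of `F`. The claim becomes a mean value inequality: for each real `η
> 0`, `|g 1 - g 0| ≤ η v`. Letting `η → 0` finishes, as `F` is Archimedean.

Real parameters would not do: an error `ε` from a set with infimum `0` may be below `η` only on a
band, so the path must be able to advance on that band alone. As `[0, 1]` is not totally ordered,
Zorn's lemma is applied to `SlowGrowth`. Chains are bounded by their suprema (`slowGrowth_of_isLUB`,
through order continuity of multiplication), and a maximal parameter is `1`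
(`eq_one_of_slowGrowth_maximal`). -/

namespace PhiAlgebra

/-! ### Disjointness and positivity in f-algebras. -/

section Lattice

variable {F : Type*} [Ring F] [Lattice F] [Algebra ℝ F] [PhiAlgebra F]

theorem mul_eq_zero_of_inf_eq_zero {a b : F} (h : a ⊓ b = 0) : a * b = 0 := by
  have ha : 0 ≤ a := h ▸ inf_le_left
  have hb : 0 ≤ b := h ▸ inf_le_right
  have h1 : (a * b) ⊓ b = 0 := inf_mul_right' a b b h hb
  have h2 : (a * b) ⊓ (a * b) = 0 := by
    rw [inf_comm]
    exact inf_mul_left' b (a * b) a (by rw [inf_comm]; exact h1) ha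
  rwa [inf_idem] at h2

/-- The cross terms in `(1⁺ - 1⁻)²` vanish by disjointness, so `1` is a sum of two products of
positive elements. -/
theorem one_nonneg : (0 : F) ≤ 1 := by
  have hd : (1 : F)⁺ ⊓ (1 : F)⁻ = 0 := posPart_inf_negPart_eq_zero 1
  have h1 : (1 : F)⁺ * (1 : F)⁻ = 0 := mul_eq_zero_of_inf_eq_zero hd
  have h2 : (1 : F)⁻ * (1 : F)⁺ = 0 := mul_eq_zero_of_inf_eq_zero (by rwa [inf_comm])
  have h3 : (1 : F) = 1⁺ * 1⁺ + 1⁻ * 1⁻ := by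
    calc (1 : F) = (1⁺ - 1⁻) * (1⁺ - 1⁻) := by rw [posPart_sub_negPart, mul_one]
      _ = 1⁺ * 1⁺ + 1⁻ * 1⁻ := by rw [sub_mul, mul_sub, mul_sub, h1, h2]; abel
  rw [h3]
  exact add_nonneg (mul_nonneg' _ _ (posPart_nonneg _) (posPart_nonneg _))
    (mul_nonneg' _ _ (negPart_nonneg _) (negPart_nonneg _))

instance : ZeroLEOneClass F := ⟨one_nonneg⟩

instance : IsOrderedRing F := IsOrderedRing.of_mul_nonneg mul_nonneg'

theorem le_of_le_add_of_inf_eq_zero {y a b : F} (ha : 0 ≤ a)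
    (h : y ≤ a + b) (hd : y ⊓ b = 0) : y ≤ a := by
  have h1 : y - a ≤ y ⊓ b := le_inf (sub_le_self y ha) (sub_le_iff_le_add'.mpr h)
  exact sub_nonpos.mp (hd ▸ h1)

theorem inf_eq_zero_mono {α : Type*} [Lattice α] [Zero α] {a b c d : α} (ha : 0 ≤ a) (hb : 0 ≤ b) (hac : a ≤ c) (hbd : b ≤ d)
    (h : c ⊓ d = 0) : a ⊓ b = 0 :=
  le_antisymm (h ▸ inf_le_inf hac hbd) (le_inf ha hb)

end Lattice

/-! ### The Archimedean property and order continuity of multiplication. -/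

section ConditionallyComplete

variable {F : Type*} [Ring F] [ConditionallyCompleteLattice F] [Algebra ℝ F] [PhiAlgebra F]

/-- The supremum `S` of the multiples of `x` satisfies `S ≤ S - x`. -/
theorem nonpos_of_forall_nsmul_le {x y : F} (h : ∀ n : ℕ, n • x ≤ y) : x ≤ 0 := by
  have hb : BddAbove (Set.range fun n : ℕ => n • x) := ⟨y, by rintro _ ⟨n, rfl⟩; exact h n⟩
  have h1 : sSup (Set.range fun n : ℕ => n • x) ≤ sSup (Set.range fun n : ℕ => n • x) - x := by
    refine csSup_le (Set.range_nonempty _) ?_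
    rintro _ ⟨n, rfl⟩
    rw [le_sub_iff_add_le]
    exact le_csSup hb ⟨n + 1, succ_nsmul x n⟩
  simpa using h1

theorem nonpos_of_forall_le_inv_smul {x y : F} (h : ∀ n : ℕ, x ≤ ((n : ℝ) + 1)⁻¹ • y) :
    x ≤ 0 := by
  have hy : ∀ n : ℕ, (n + 1) • x ≤ y := by
    intro n
    have h1 := smul_le_smul_of_nonneg_left (h n) (by positivity : (0 : ℝ) ≤ (n : ℝ) + 1)
    rw [smul_inv_smul₀ (by positivity)] at h1
    rw [← Nat.cast_smul_eq_nsmul ℝ]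
    exact_mod_cast h1
  refine nonpos_of_forall_nsmul_le (x := x) (y := y - x) fun n => ?_
  rw [le_sub_iff_add_le, ← succ_nsmul]
  exact hy n

theorem decreasesToZero_inv_smul {v : F} (hv : 0 ≤ v) :
    DecreasesToZero (Set.range fun n : ℕ => ((n : ℝ) + 1)⁻¹ • v) := by
  refine ⟨⟨?_, fun x hx => nonpos_of_forall_le_inv_smul fun n => hx ⟨n, rfl⟩⟩, ?_⟩
  · rintro _ ⟨n, rfl⟩
    exact smul_nonneg (by positivity) hv
  · rintro _ ⟨m, rfl⟩ _ ⟨n, rfl⟩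
    have key : ∀ a b : ℕ, a ≤ b → ((b : ℝ) + 1)⁻¹ • v ≤ ((a : ℝ) + 1)⁻¹ • v := by
      intro a b hab
      have hab' : (a : ℝ) ≤ b := by exact_mod_cast hab
      have : ((b : ℝ) + 1)⁻¹ ≤ ((a : ℝ) + 1)⁻¹ := by gcongr
      have h := smul_nonneg (sub_nonneg.mpr this) hv
      rwa [sub_smul, sub_nonneg] at h
    exact ⟨_, ⟨max m n, rfl⟩, key _ _ (le_max_left _ _), key _ _ (le_max_right _ _)⟩

/-- The bands on which `v` is below some `n` exhaust `F`: disjointness from all of them forces `n x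
≤ x v` for every `n`. This allows `v` to be treated as bounded. -/
theorem eq_zero_of_forall_inf_nsmul_sub {x v : F} (hx : 0 ≤ x)
    (h : ∀ n : ℕ, x ⊓ (n • (1 : F) - v)⁺ = 0) : x = 0 := by
  refine le_antisymm (nonpos_of_forall_nsmul_le (y := x * v) fun n => ?_) hx
  have h1 : x * (n • (1 : F) - v)⁺ = 0 := mul_eq_zero_of_inf_eq_zero (h n)
  have h2 : x * (n • (1 : F) - v) ≤ 0 := h1 ▸ mul_le_mul_of_nonneg_left (le_posPart _) hx
  rwa [mul_sub, mul_smul_comm, mul_one, sub_nonpos] at h2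

theorem posPart_sub_inf_posPart_sub (a b : F) : (a - b)⁺ ⊓ (b - a)⁺ = 0 := by
  rw [← neg_sub a b, posPart_neg]
  exact posPart_inf_negPart_eq_zero _

/-- Right multiplication by a positive element is order continuous. -/
theorem nonpos_of_forall_le_mul_right {A : Set F} (hA : InfZero A) {v x : F}
    (h : ∀ a ∈ A, x ≤ a * v) : x ≤ 0 := by
  refine posPart_eq_zero.mp (eq_zero_of_forall_inf_nsmul_sub (v := v⁺) (posPart_nonneg _)
    fun n => ?_)
  have hy : 0 ≤ x⁺ ⊓ (n • (1 : F) - v⁺)⁺ := le_inf (posPart_nonneg _) (posPart_nonneg _)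
  -- Here `a v⁺ ≤ n a + a (v⁺ - n)⁺`, and the last term is disjoint from the left-hand side.
  have hn : ∀ a ∈ A, x⁺ ⊓ (n • (1 : F) - v⁺)⁺ ≤ n • a := by
    intro a ha
    have ha0 : 0 ≤ a := hA.1 ha
    have hle : x⁺ ≤ a * v⁺ := sup_le
      ((h a ha).trans (mul_le_mul_of_nonneg_left (le_posPart v) ha0))
      (mul_nonneg ha0 (posPart_nonneg v))
    refine le_of_le_add_of_inf_eq_zero (b := a * (v⁺ - n • (1 : F))⁺)
      (nsmul_nonneg ha0 n) ?_ ?_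
    · refine (inf_le_left.trans hle).trans ?_
      have h1 := mul_le_mul_of_nonneg_left (le_posPart (v⁺ - n • (1 : F))) ha0
      rw [mul_sub, mul_smul_comm, mul_one, sub_le_iff_le_add'] at h1
      exact h1
    · rw [inf_comm]
      refine inf_mul_left' _ _ _ ?_ ha0
      exact inf_eq_zero_mono (posPart_nonneg _) hy le_rfl inf_le_right
        (posPart_sub_inf_posPart_sub _ _)
  -- The scalar `n + 1` replaces `n` so that it is invertible also for `n = 0`.
  have hz : ((n : ℝ) + 1)⁻¹ • (x⁺ ⊓ (n • (1 : F) - v⁺)⁺) ≤ 0 := hA.2 fun a ha => by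
    have h1 : x⁺ ⊓ (n • (1 : F) - v⁺)⁺ ≤ ((n : ℝ) + 1) • a := by
      rw [add_smul, one_smul, Nat.cast_smul_eq_nsmul]
      exact (hn a ha).trans (le_add_of_nonneg_right (hA.1 ha))
    have h2 := smul_le_smul_of_nonneg_left h1 (by positivity : (0 : ℝ) ≤ ((n : ℝ) + 1)⁻¹)
    rwa [inv_smul_smul₀ (by positivity)] at h2
  refine le_antisymm ?_ hy
  have h3 := smul_le_smul_of_nonneg_left hz (by positivity : (0 : ℝ) ≤ (n : ℝ) + 1)
  rwa [smul_inv_smul₀ (by positivity), smul_zero] at h3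

/-- Left multiplication by a positive element is order continuous. -/
theorem nonpos_of_forall_le_mul_left {A : Set F} (hA : InfZero A) {v x : F}
    (h : ∀ a ∈ A, x ≤ v * a) : x ≤ 0 := by
  refine posPart_eq_zero.mp (eq_zero_of_forall_inf_nsmul_sub (v := v⁺) (posPart_nonneg _)
    fun n => ?_)
  have hy : 0 ≤ x⁺ ⊓ (n • (1 : F) - v⁺)⁺ := le_inf (posPart_nonneg _) (posPart_nonneg _)
  have hn : ∀ a ∈ A, x⁺ ⊓ (n • (1 : F) - v⁺)⁺ ≤ n • a := by
    intro a ha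
    have ha0 : 0 ≤ a := hA.1 ha
    have hle : x⁺ ≤ v⁺ * a := sup_le
      ((h a ha).trans (mul_le_mul_of_nonneg_right (le_posPart v) ha0))
      (mul_nonneg (posPart_nonneg v) ha0)
    refine le_of_le_add_of_inf_eq_zero (b := (v⁺ - n • (1 : F))⁺ * a)
      (nsmul_nonneg ha0 n) ?_ ?_
    · refine (inf_le_left.trans hle).trans ?_
      have h1 := mul_le_mul_of_nonneg_right (le_posPart (v⁺ - n • (1 : F))) ha0
      rw [sub_mul, smul_mul_assoc, one_mul, sub_le_iff_le_add'] at h1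
      exact h1
    · rw [inf_comm]
      refine inf_mul_right' _ _ _ ?_ ha0
      exact inf_eq_zero_mono (posPart_nonneg _) hy le_rfl inf_le_right
        (posPart_sub_inf_posPart_sub _ _)
  have hz : ((n : ℝ) + 1)⁻¹ • (x⁺ ⊓ (n • (1 : F) - v⁺)⁺) ≤ 0 := hA.2 fun a ha => by
    have h1 : x⁺ ⊓ (n • (1 : F) - v⁺)⁺ ≤ ((n : ℝ) + 1) • a := by
      rw [add_smul, one_smul, Nat.cast_smul_eq_nsmul]
      exact (hn a ha).trans (le_add_of_nonneg_right (hA.1 ha))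
    have h2 := smul_le_smul_of_nonneg_left h1 (by positivity : (0 : ℝ) ≤ ((n : ℝ) + 1)⁻¹)
    rwa [inv_smul_smul₀ (by positivity)] at h2
  refine le_antisymm ?_ hy
  have h3 := smul_le_smul_of_nonneg_left hz (by positivity : (0 : ℝ) ≤ (n : ℝ) + 1)
  rwa [smul_inv_smul₀ (by positivity), smul_zero] at h3

end ConditionallyComplete

end PhiAlgebra

/-! ### The modulus as an `F`-valued norm. -/

namespace Complexification

open PhiAlgebra

variable {F : Type*} [Ring F] [ConditionallyCompleteLattice F] [Algebra ℝ F] [PhiAlgebra F]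

theorem le_modulus (z : Complexification F) (θ : ℝ) :
    Real.cos θ • z.re + Real.sin θ • z.im ≤ modulus z := by
  have hper : Function.Periodic (fun θ : ℝ => Real.cos θ • z.re + Real.sin θ • z.im)
      (2 * Real.pi) := fun t => by simp
  obtain ⟨t, ht, hθ⟩ := hper.exists_mem_Ico₀ Real.two_pi_pos θ
  exact hθ.trans_le ((isLUB_modulus z).1 ⟨t, Set.Ico_subset_Icc_self ht, rfl⟩)

theorem neg_le_modulus (z : Complexification F) (θ : ℝ) :
    -(Real.cos θ • z.re + Real.sin θ • z.im) ≤ modulus z := by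
  have h := le_modulus z (θ + Real.pi)
  rwa [Real.cos_add_pi, Real.sin_add_pi, neg_smul, neg_smul, ← neg_add] at h

theorem modulus_le {z : Complexification F} {b : F}
    (h : ∀ θ : ℝ, Real.cos θ • z.re + Real.sin θ • z.im ≤ b) : modulus z ≤ b := by
  refine (isLUB_modulus z).2 ?_
  rintro _ ⟨θ, -, rfl⟩
  exact h θ

theorem re_le_modulus (z : Complexification F) : z.re ≤ modulus z := by
  simpa using le_modulus z 0

theorem im_le_modulus (z : Complexification F) : z.im ≤ modulus z := by
  simpa using le_modulus z (Real.pi / 2)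

theorem neg_re_le_modulus (z : Complexification F) : -z.re ≤ modulus z := by
  simpa using neg_le_modulus z 0

theorem neg_im_le_modulus (z : Complexification F) : -z.im ≤ modulus z := by
  simpa using neg_le_modulus z (Real.pi / 2)

theorem modulus_nonneg (z : Complexification F) : 0 ≤ modulus z := by
  have h := add_le_add (re_le_modulus z) (neg_re_le_modulus z)
  rw [add_neg_cancel, ← two_smul ℝ] at h
  have h2 := smul_nonneg (by positivity : (0 : ℝ) ≤ 2⁻¹) h
  rwa [inv_smul_smul₀ two_ne_zero] at h2

theorem eq_zero_of_modulus_le_zero {z : Complexification F} (h : modulus z ≤ 0) : z = 0 := by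
  ext
  · exact le_antisymm ((re_le_modulus z).trans h) (neg_nonpos.mp ((neg_re_le_modulus z).trans h))
  · exact le_antisymm ((im_le_modulus z).trans h) (neg_nonpos.mp ((neg_im_le_modulus z).trans h))

theorem modulus_zero : modulus (0 : Complexification F) = 0 :=
  le_antisymm (modulus_le fun θ => by simp) (modulus_nonneg _)

theorem modulus_neg_le (z : Complexification F) : modulus (-z) ≤ modulus z :=
  modulus_le fun θ => by simpa [add_comm] using neg_le_modulus z θ

theorem modulus_sub_comm_le (z w : Complexification F) : modulus (z - w) ≤ modulus (w - z) := by
  simpa using modulus_neg_le (w - z)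

theorem modulus_add_le (z w : Complexification F) :
    modulus (z + w) ≤ modulus z + modulus w :=
  modulus_le fun θ => by
    have h := add_le_add (le_modulus z θ) (le_modulus w θ)
    refine le_trans (le_of_eq ?_) h
    simp only [QuadraticAlgebra.re_add, QuadraticAlgebra.im_add, smul_add]
    abel

/-- For each real part `t` of a rotation of `z`, `a t = a⁺ t + a⁻ (-t)`, and both `t` and `-t` lie
below the modulus. -/
theorem modulus_smul_le (a : F) (z : Complexification F) :
    modulus (a • z) ≤ |a| * modulus z :=
  modulus_le fun θ => by
    have h1 : Real.cos θ • (a • z).re + Real.sin θ • (a • z).im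
        = a * (Real.cos θ • z.re + Real.sin θ • z.im) := by
      simp only [QuadraticAlgebra.re_smul, QuadraticAlgebra.im_smul, smul_eq_mul, mul_add,
        mul_smul_comm]
    have h2 := mul_le_mul_of_nonneg_left (le_modulus z θ) (posPart_nonneg a)
    have h3 := mul_le_mul_of_nonneg_left (neg_le_modulus z θ) (negPart_nonneg a)
    rw [h1, ← posPart_add_negPart a, add_mul]
    refine le_trans (le_of_eq ?_) (add_le_add h2 h3)
    rw [mul_neg, ← sub_eq_add_neg, ← sub_mul, posPart_sub_negPart]

end Complexification

/-! ### The mean value inequality along an `F`-valued parameter. -/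

section Path

open PhiAlgebra Complexification

variable {F : Type*} [Ring F] [ConditionallyCompleteLattice F] [Algebra ℝ F] [PhiAlgebra F]

theorem IsWeakOrderUnit.mono {s t : F} (hs : IsWeakOrderUnit s) (h : s ≤ t) :
    IsWeakOrderUnit t :=
  ⟨hs.1.trans h, fun x hx => hs.2 x (inf_eq_zero_mono hs.1 (abs_nonneg x) h le_rfl hx)⟩

/-- `g` has order derivative zero along the order interval `[0, 1]` of `F`, with respect to the
scale `v`. -/
def HasZeroDerivOnUnitInterval (g : F → Complexification F) (v : F) : Prop :=
  ∀ a : F, 0 ≤ a → a ≤ 1 → ∀ Δ : Set F, DecreasesToZero Δ → ∃ Ε : Set F, InfZero Ε ∧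
    ∀ ε ∈ Ε, ∃ δ ∈ Δ, ∀ b : F, 0 ≤ b → b ≤ 1 → |b - a| * v ≤ δ →
      modulus (g b - g a) ≤ |b - a| * v * ε

/-- The order on the path parameters along which `g` grows at rate at most `v * e`. -/
def SlowGrowth (g : F → Complexification F) (v e a b : F) : Prop :=
  a ≤ b ∧ modulus (g b - g a) ≤ (b - a) * v * e

theorem SlowGrowth.refl (g : F → Complexification F) (v e a : F) : SlowGrowth g v e a a :=
  ⟨le_rfl, by simp [modulus_zero]⟩

theorem SlowGrowth.trans {g : F → Complexification F} {v e a b c : F}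
    (hab : SlowGrowth g v e a b) (hbc : SlowGrowth g v e b c) : SlowGrowth g v e a c := by
  refine ⟨hab.1.trans hbc.1, ?_⟩
  have h1 := modulus_add_le (g c - g b) (g b - g a)
  rw [sub_add_sub_cancel] at h1
  refine h1.trans ((add_le_add hbc.2 hab.2).trans (le_of_eq ?_))
  rw [← add_mul, ← add_mul, sub_add_sub_cancel]

/-- The distances to the supremum of a chain, multiplied by a positive element, decrease to
zero. -/
theorem decreasesToZero_sub_mul_of_isLUB {C : Set F} {s v : F} (hC : IsLUB C s)
    (hdir : DirectedOn (· ≤ ·) C) (hv : 0 ≤ v) :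
    DecreasesToZero ((fun a => (s - a) * v) '' C) := by
  have hinf : InfZero ((fun a => s - a) '' C) := by
    refine ⟨?_, fun x hx => ?_⟩
    · rintro _ ⟨a, ha, rfl⟩
      exact sub_nonneg.mpr (hC.1 ha)
    · have : s ≤ s - x := hC.2 fun a ha => le_sub_comm.mp (hx ⟨a, ha, rfl⟩)
      simpa using this
  refine ⟨⟨?_, fun x hx => ?_⟩, ?_⟩
  · rintro _ ⟨a, ha, rfl⟩
    exact mul_nonneg (sub_nonneg.mpr (hC.1 ha)) hv
  · refine nonpos_of_forall_le_mul_right hinf (v := v) ?_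
    rintro _ ⟨a, ha, rfl⟩
    exact hx ⟨a, ha, rfl⟩
  · rintro _ ⟨a, ha, rfl⟩ _ ⟨b, hb, rfl⟩
    obtain ⟨c, hc, hac, hbc⟩ := hdir a ha b hb
    exact ⟨_, ⟨c, hc, rfl⟩, mul_le_mul_of_nonneg_right (sub_le_sub_left hac s) hv,
      mul_le_mul_of_nonneg_right (sub_le_sub_left hbc s) hv⟩

/-- Differentiability at `s` is tested against the distances `(s - b) v` from the chain to `s`. The
jump from a suitable `b` to `s` costs at most `(s - b) v ε ≤ v ε`, which has no positive lower bound
as `ε` varies. -/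
theorem slowGrowth_of_isLUB {g : F → Complexification F} {v e s a : F}
    (hg : HasZeroDerivOnUnitInterval g v) (hv : 0 ≤ v) (he : 0 ≤ e) {C : Set F}
    (hC : IsLUB C s) (hchain : IsChain (SlowGrowth g v e) C) (hC0 : ∀ b ∈ C, 0 ≤ b ∧ b ≤ 1)
    (ha : a ∈ C) : SlowGrowth g v e a s := by
  have hrel : ∀ b ∈ C, ∀ c ∈ C, SlowGrowth g v e b c ∨ SlowGrowth g v e c b := by
    intro b hb c hc
    by_cases h : b = c
    · exact Or.inl (h ▸ SlowGrowth.refl g v e b)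
    · exact hchain hb hc h
  -- This tail of the chain has the same supremum, and each of its points carries the growth bound
  -- from `a`.
  set T : Set F := {b ∈ C | SlowGrowth g v e a b}
  have hs0 : 0 ≤ s := (hC0 a ha).1.trans (hC.1 ha)
  have hs1 : s ≤ 1 := hC.2 fun b hb => (hC0 b hb).2
  have hTs : IsLUB T s := by
    refine ⟨fun b hb => hC.1 hb.1, fun x hx => hC.2 fun b hb => ?_⟩
    rcases hrel a ha b hb with h | h
    · exact hx ⟨hb, h⟩
    · exact h.1.trans (hx ⟨ha, SlowGrowth.refl g v e a⟩)
  have hTdir : DirectedOn (· ≤ ·) T := by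
    intro b hb c hc
    rcases hrel b hb.1 c hc.1 with h | h
    · exact ⟨c, hc, h.1, le_rfl⟩
    · exact ⟨b, hb, le_rfl, h.1⟩
  obtain ⟨Ε, hΕ, hd⟩ := hg s hs0 hs1 _ (decreasesToZero_sub_mul_of_isLUB hTs hTdir hv)
  refine ⟨hC.1 ha, sub_nonpos.mp (nonpos_of_forall_le_mul_left hΕ (v := v) fun ε hε => ?_)⟩
  have hε0 : 0 ≤ ε := hΕ.1 hε
  obtain ⟨_, ⟨b, hb, rfl⟩, hδ⟩ := hd ε hε
  have hbs : b ≤ s := hC.1 hb.1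
  have habs : |b - s| = s - b := by
    rw [abs_sub_comm, abs_of_nonneg (sub_nonneg.mpr hbs)]
  have h1 := hδ b (hC0 b hb.1).1 (hC0 b hb.1).2 (by rw [habs])
  rw [habs] at h1
  have h2 : modulus (g s - g a) ≤ (s - b) * v * ε + (b - a) * v * e := by
    have h3 := modulus_add_le (g s - g b) (g b - g a)
    rw [sub_add_sub_cancel] at h3
    exact h3.trans (add_le_add ((modulus_sub_comm_le _ _).trans h1) hb.2.2)
  rw [sub_le_iff_le_add]
  refine h2.trans (add_le_add ?_ ?_)
  · refine mul_le_mul_of_nonneg_right ?_ hε0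
    have h4 : s - b ≤ 1 := (sub_le_self s (hC0 b hb.1).1).trans hs1
    simpa using mul_le_mul_of_nonneg_right h4 hv
  · exact mul_le_mul_of_nonneg_right
      (mul_le_mul_of_nonneg_right (sub_le_sub_right hbs a) hv) he

/-- Maximality forbids any advance where `ε < η`, so `1 - a` lives where `ε ≥ η`. Hence `η (1 - a) ≤
ε` for every `ε`, and the infimum gives `a = 1`. -/
theorem eq_one_of_slowGrowth_maximal {g : F → Complexification F} {v a : F} {η : ℝ} (hη : 0 < η)
    (hg : HasZeroDerivOnUnitInterval g v) (hv : 0 ≤ v) (ha0 : 0 ≤ a) (ha1 : a ≤ 1)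
    (hmax : ∀ b, b ≤ 1 → SlowGrowth g v (η • 1) a b → b ≤ a) : a = 1 := by
  obtain ⟨Ε, hΕ, hd⟩ := hg a ha0 ha1 _ (decreasesToZero_inv_smul hv)
  have hu : 0 ≤ 1 - a := sub_nonneg.mpr ha1
  have hu1 : 1 - a ≤ 1 := sub_le_self 1 ha0
  refine le_antisymm ha1 (sub_nonpos.mp ?_)
  have key : η • (1 - a) ≤ 0 := hΕ.2 fun ε hε => ?_
  · have h := smul_le_smul_of_nonneg_left key (inv_nonneg.mpr hη.le)
    rwa [inv_smul_smul₀ hη.ne', smul_zero] at h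
  have hε0 : 0 ≤ ε := hΕ.1 hε
  obtain ⟨_, ⟨n, rfl⟩, hδ⟩ := hd ε hε
  have hn0 : (0 : ℝ) < ((n : ℝ) + 1)⁻¹ := by positivity
  have hn1 : ((n : ℝ) + 1)⁻¹ ≤ 1 := inv_le_one_of_one_le₀ (by simp)
  -- The first term keeps the advance inside `[0, 1]`, the second confines it to the band where `ε <
  -- η`. Scaling by `1/(n + 1)` then meets the threshold `δ = v/(n + 1)`.
  set w : F := (1 - a) ⊓ (η • 1 - ε)⁺
  have hw0 : 0 ≤ w := le_inf hu (posPart_nonneg _)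
  set m : F := ((n : ℝ) + 1)⁻¹ • w with hm
  have hm0 : 0 ≤ m := smul_nonneg hn0.le hw0
  have hmw : m ≤ w := by
    have h := smul_nonneg (sub_nonneg.mpr hn1) hw0
    rwa [sub_smul, one_smul, sub_nonneg] at h
  have hm1 : a + m ≤ 1 := by
    rw [← le_sub_iff_add_le']
    exact hmw.trans inf_le_left
  have hmv : m * v ≤ ((n : ℝ) + 1)⁻¹ • v := by
    rw [hm, smul_mul_assoc]
    refine smul_le_smul_of_nonneg_left ?_ hn0.le
    simpa using mul_le_mul_of_nonneg_right (inf_le_left.trans hu1 : w ≤ 1) hv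
  have h1 := hδ (a + m) (add_nonneg ha0 hm0) hm1
    (by rwa [add_sub_cancel_left, abs_of_nonneg hm0])
  rw [add_sub_cancel_left, abs_of_nonneg hm0] at h1
  have hdisj : (m * v) * (ε - η • 1)⁺ = 0 := by
    refine mul_eq_zero_of_inf_eq_zero (inf_mul_right' _ _ _ ?_ hv)
    exact inf_eq_zero_mono hm0 (posPart_nonneg _) (hmw.trans inf_le_right) le_rfl
      (posPart_sub_inf_posPart_sub _ _)
  have h2 : (m * v) * ε ≤ (m * v) * (η • 1) := by
    have h := mul_le_mul_of_nonneg_left (le_posPart (ε - η • 1)) (mul_nonneg hm0 hv)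
    rwa [hdisj, mul_sub, sub_nonpos] at h
  have h3 : a + m ≤ a := hmax _ hm1
    ⟨le_add_of_nonneg_right hm0, by rw [add_sub_cancel_left]; exact h1.trans h2⟩
  have hmz : m = 0 := le_antisymm (by simpa using h3) hm0
  have hwz : w = 0 := (smul_eq_zero_iff_right hn0.ne').mp hmz
  have h4 : (1 - a) * (η • 1 - ε)⁺ = 0 := mul_eq_zero_of_inf_eq_zero hwz
  have h5 := mul_le_mul_of_nonneg_left (le_posPart (η • 1 - ε)) hu
  rw [h4, mul_sub, sub_nonpos, mul_smul_comm, mul_one] at h5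
  refine h5.trans ?_
  simpa using mul_le_mul_of_nonneg_right hu1 hε0

/-- The mean value inequality along the order interval `[0, 1]`. -/
theorem slowGrowth_zero_one {g : F → Complexification F} {v : F} {η : ℝ} (hη : 0 < η)
    (hg : HasZeroDerivOnUnitInterval g v) (hv : 0 ≤ v) : SlowGrowth g v (η • 1) 0 1 := by
  have he : (0 : F) ≤ η • 1 := smul_nonneg hη.le zero_le_one
  let S := {a : F // a ≤ 1 ∧ SlowGrowth g v (η • 1) 0 a}
  -- The start `0` bounds the empty chain; any other chain is bounded by its supremum.
  obtain ⟨m, hm⟩ := exists_maximal_of_chains_bounded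
    (r := fun a b : S => SlowGrowth g v (η • 1) a.1 b.1)
    (fun C hC => by
      rcases C.eq_empty_or_nonempty with rfl | ⟨a, ha⟩
      · exact ⟨⟨0, zero_le_one, SlowGrowth.refl _ _ _ _⟩, by simp⟩
      · have hbd : BddAbove (Subtype.val '' C) := ⟨1, by rintro _ ⟨b, -, rfl⟩; exact b.2.1⟩
        have hlub := isLUB_csSup ⟨a.1, Set.mem_image_of_mem Subtype.val ha⟩ hbd
        have hchain : IsChain (SlowGrowth g v (η • 1)) (Subtype.val '' C) := by
          rintro _ ⟨b, hb, rfl⟩ _ ⟨c, hc, rfl⟩ hbc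
          exact hC hb hc fun h => hbc (congrArg _ h)
        have hub : ∀ b ∈ C, SlowGrowth g v (η • 1) b.1 (sSup (Subtype.val '' C)) := fun b hb =>
          slowGrowth_of_isLUB hg hv he hlub hchain
            (by rintro _ ⟨c, -, rfl⟩; exact ⟨c.2.2.1, c.2.1⟩) ⟨b, hb, rfl⟩
        exact ⟨⟨_, hlub.2 (by rintro _ ⟨b, -, rfl⟩; exact b.2.1), a.2.2.trans (hub a ha)⟩, hub⟩)
    (fun hab hbc => hab.trans hbc)
  have hm1 : m.1 = 1 := eq_one_of_slowGrowth_maximal hη hg hv m.2.2.1 m.2.1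
    fun b hb hmb => (hm ⟨b, hb, m.2.2.trans hmb⟩ hmb).1
  have h := m.2.2
  rwa [hm1] at h

theorem eq_of_hasZeroDerivOnUnitInterval {g : F → Complexification F} {v : F}
    (hg : HasZeroDerivOnUnitInterval g v) (hv : 0 ≤ v) : g 1 = g 0 := by
  refine sub_eq_zero.mp (eq_zero_of_modulus_le_zero
    (nonpos_of_forall_le_inv_smul (y := v) fun n => ?_))
  have h := (slowGrowth_zero_one (by positivity : (0 : ℝ) < ((n : ℝ) + 1)⁻¹) hg hv).2
  rwa [sub_zero, one_mul, mul_smul_comm, mul_one] at h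

/-- Order neighbourhoods are star-shaped about their centre even for scalars from `F`, so the path
stays in the domain. -/
theorem center_add_smul_mem_orderNhd {c z : Complexification F} {r a : F}
    (hz : z ∈ orderNhd c r) (ha0 : 0 ≤ a) (ha1 : a ≤ 1) : c + a • (z - c) ∈ orderNhd c r := by
  refine IsWeakOrderUnit.mono hz (sub_le_sub_left ?_ r)
  rw [add_sub_cancel_left]
  refine (modulus_smul_le _ _).trans ?_
  rw [abs_of_nonneg ha0]
  simpa using mul_le_mul_of_nonneg_right ha1 (modulus_nonneg (z - c))

end Path

/-! ### Reduction to the path from the centre. -/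

theorem mainTheorem11 {F : Type*} [Ring F] [ConditionallyCompleteLattice F] [Algebra ℝ F]
    [PhiAlgebra F] (c : Complexification F) (r : F) (hr : IsWeakOrderUnit r)
    (f : orderNhd c r → Complexification F)
    (hf : ∀ p : orderNhd c r, HasSuperOrderDerivAt f p 0) :
    ∃ k : Complexification F, ∀ z : orderNhd c r, f z = k := by
  classical
  have hc : c ∈ orderNhd c r := by
    simpa [orderNhd, OrderLL, Complexification.modulus_zero] using hr
  refine ⟨f ⟨c, hc⟩, fun z => ?_⟩
  -- The default `0` is never met for `a` in `[0, 1]`.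
  let g : F → Complexification F := fun a =>
    if h : c + a • ((z : Complexification F) - c) ∈ orderNhd c r then f ⟨_, h⟩ else 0
  have hgval : ∀ a (h : c + a • ((z : Complexification F) - c) ∈ orderNhd c r),
      g a = f ⟨_, h⟩ := fun a h => dif_pos h
  have hg : HasZeroDerivOnUnitInterval g (Complexification.modulus ((z : Complexification F) - c)) := by
    intro a ha0 ha1 Δ hΔ
    have ha := center_add_smul_mem_orderNhd z.2 ha0 ha1
    obtain ⟨s, -, -, H⟩ := hf ⟨_, ha⟩
    obtain ⟨Ε, hΕ, hd⟩ := H Δ hΔ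
    refine ⟨Ε, hΕ, fun ε hε => ?_⟩
    obtain ⟨δ, hδ, h⟩ := hd ε hε
    refine ⟨δ, hδ, fun b hb0 hb1 hba => ?_⟩
    have hb := center_add_smul_mem_orderNhd z.2 hb0 hb1
    -- This one bound both meets the threshold `δ` and enlarges the error term to the required form.
    have hsub : Complexification.modulus ((c + b • ((z : Complexification F) - c)) -
        (c + a • ((z : Complexification F) - c))) ≤
          |b - a| * Complexification.modulus ((z : Complexification F) - c) := by
      rw [add_sub_add_left_eq_sub, ← sub_smul]
      exact Complexification.modulus_smul_le _ _
    have h1 := h ⟨_, hb⟩ (hsub.trans hba)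
    rw [mul_zero, sub_zero] at h1
    rw [hgval a ha, hgval b hb]
    exact h1.trans (mul_le_mul_of_nonneg_right hsub (hΕ.1 hε))
  have h01 := eq_of_hasZeroDerivOnUnitInterval hg (Complexification.modulus_nonneg _)
  have h0 : g 0 = f ⟨c, hc⟩ := by
    rw [hgval 0 (by simpa using hc)]
    congr 1
    simp
  have h1 : g 1 = f z := by
    rw [hgval 1 (by simp)]
    congr 1
    simp
  rw [← h1, h01, h0]
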